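/- Let $d\ge 1$ and let $2^*=\frac{2d}{d-2}$ if $d\ge 3$, $2^*=\infty$ if $d\in\{1,2\}$. Let $W(s)=\frac{\Omega^2}{2}|s|^2+N(s)$ for $s\in\mathbb R$, where $\Omega\in\mathbb R$ and $N:\mathbb R\to\mathbb R$ is differentiable, even (radially symmetric), with $N(0)=N'(0)=N''(0)=0$ and $$|N'(s)|\le c_1|s|^{q-1}+c_2|s|^{p-1}\quad (s\in\mathbb R)$$ for some constants $c_1,c_2>0$ and $2<q\le p<2^*$. Assume $W(s)\ge 0$ for all $s$. Let $D\subset\mathbb R^d$ be a bounded set with non-empty interior (for instance a bounded open set, or a compact set with non-empty interior), and let $H^1_0(D)$ be the closure of $C_c^\infty(\operatorname{int} D)$ in $H^1(\mathbb R^d)$ (real-valued functions, extended by zero outside $D$). For $\varepsilon>0$, $C\in\mathbb R$ put $$E_\varepsilon(u,\omega)=\int_D \Big(\varepsilon^2\frac{|\nabla u|^2}{2}+W(u)+\frac{\omega^2u^2}{2}\Big)\,dx,\qquad M_C(D)=\Big\{(u,\omega)\in H^1_0(D)\times\mathbb R:\ \omega\int_D u^2\,dx=C\Big\}.$$ Then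 for every $\varepsilon>0$ and every charge $\sigma\in\mathbb R$: the integrand of $E_\varepsilon(u,\omega)$ is integrable on $D$ for all $(u,\omega)\in H^1_0(D)\times\mathbb R$, and the infimum $$m_\sigma(\varepsilon,D)=\inf\{E_\varepsilon(u,\omega):\ (u,\omega)\in M_{\sigma\varepsilon^d}(D)\}$$ is attained, i.e. there is $(u,\omega)\in M_{\sigma\varepsilon^d}(D)$ with $E_\varepsilon(u,\omega)=m_\sigma(\varepsilon,D)\le E_\varepsilon(u',\omega')$ for all $(u',\omega')\in M_{\sigma\varepsilon^d}(D)$. -/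

import Mathlib

open MeasureTheory

namespace KleinGordon

noncomputable section

/-- The Euclidean space `ℝ^d`. -/
abbrev Space (d : ℕ) := EuclideanSpace ℝ (Fin d)

/-- `φ ∈ C_c^∞(U)`: a smooth function whose support is a compact subset of `U`. -/
structure IsTestFunction {d : ℕ} (U : Set (Space d)) (φ : Space d → ℝ) : Prop where
  smooth : ContDiff ℝ ((⊤ : ℕ∞) : WithTop ℕ∞) φ
  compactSupport : HasCompactSupport φ
  support_subset : tsupport φ ⊆ U

/-- `g` is the weak gradient of `u` on `ℝ^d`:
`∫ u ∂ᵢφ = - ∫ gᵢ φ` for every test function `φ` and every coordinate `i`. -/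
def IsWeakGradient {d : ℕ} (u : Space d → ℝ) (g : Space d → Space d) : Prop :=
  ∀ φ : Space d → ℝ, IsTestFunction Set.univ φ → ∀ i : Fin d,
    ∫ x, u x * gradient φ x i = - ∫ x, g x i * φ x

/-- The Sobolev space `H¹(ℝ^d)`: the (classes of) functions `u ∈ L²(ℝ^d)` having a weak gradient
in `L²`. The weak gradient, which is determined by `u`, is carried along as the field `grad`. -/
structure H1 (d : ℕ) where
  fn : Lp ℝ 2 (volume : Measure (Space d))
  grad : Lp (Space d) 2 (volume : Measure (Space d))
  isWeakGradient : IsWeakGradient fn grad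

/-- `H¹₀(D)`: the closure of `C_c^∞(int D)` in `H¹(ℝ^d)`. Its elements are functions on `ℝ^d`
(extended by zero outside `D`); for open `D` the interior is `D` itself. -/
def H10 {d : ℕ} (D : Set (Space d)) : Set (H1 d) :=
  {u | ∀ δ : ENNReal, 0 < δ → ∃ φ : Space d → ℝ, IsTestFunction (interior D) φ ∧
    eLpNorm (fun x => u.fn x - φ x) 2 volume < δ ∧
    eLpNorm (fun x => u.grad x - gradient φ x) 2 volume < δ}

/-- The critical Sobolev exponent `2^*`: it is `2d/(d-2)` for `d ≥ 3` and `∞` for `d ≤ 2`. -/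
def criticalExponent (d : ℕ) : EReal :=
  if d ≤ 2 then ⊤ else ((2 * (d : ℝ) / ((d : ℝ) - 2) : ℝ) : EReal)

/-- The potential `W(s) = Ω²/2 |s|² + N(s)`. -/
def potential (Ω : ℝ) (N : ℝ → ℝ) (s : ℝ) : ℝ :=
  Ω ^ 2 / 2 * |s| ^ 2 + N s

/-- The energy density `ε² |∇u|²/2 + W(u) + ω² u²/2`. -/
def energyDensity {d : ℕ} (W : ℝ → ℝ) (ε : ℝ) (u : H1 d) (ω : ℝ) (x : Space d) : ℝ :=
  ε ^ 2 * (‖u.grad x‖ ^ 2 / 2) + W (u.fn x) + ω ^ 2 * (u.fn x) ^ 2 / 2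

/-- The energy `E_ε(u, ω)` on `D`. -/
def energy {d : ℕ} (W : ℝ → ℝ) (ε : ℝ) (D : Set (Space d)) (z : H1 d × ℝ) : ℝ :=
  ∫ x in D, energyDensity W ε z.1 z.2 x

/-- The constraint `M_C(D) = {(u, ω) ∈ H¹₀(D) × ℝ : ω ∫_D u² = C}`. -/
def constraint {d : ℕ} (C : ℝ) (D : Set (Space d)) : Set (H1 d × ℝ) :=
  {z | z.1 ∈ H10 D ∧ z.2 * ∫ x in D, (z.1.fn x) ^ 2 = C}

/-- `m_σ(ε, D)`, the infimum of `E_ε` over `M_{σ ε^d}(D)`. -/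
def minEnergy {d : ℕ} (W : ℝ → ℝ) (σ ε : ℝ) (D : Set (Space d)) : ℝ :=
  sInf (energy W ε D '' constraint (σ * ε ^ d) D)

/-- The hypotheses on the nonlinear term `N`: it is differentiable, radially symmetric, vanishes
to second order at `0`, and satisfies the growth condition
`|N'(s)| ≤ c₁|s|^(q-1) + c₂|s|^(p-1)` with `c₁, c₂ > 0` and `2 < q ≤ p < 2^*`. -/
structure IsAdmissible (d : ℕ) (N : ℝ → ℝ) : Prop where
  differentiable : Differentiable ℝ N
  radial : ∀ s, N s = N |s|
  zero : N 0 = 0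
  deriv_zero : deriv N 0 = 0
  deriv_deriv_zero : HasDerivAt (deriv N) 0 0
  growth : ∃ c₁ c₂ q p : ℝ, 0 < c₁ ∧ 0 < c₂ ∧ 2 < q ∧ q ≤ p ∧ (p : EReal) < criticalExponent d ∧
    ∀ s, |deriv N s| ≤ c₁ * |s| ^ (q - 1) + c₂ * |s| ^ (p - 1)

end

end KleinGordon

/-!
The proof is the direct method of the calculus of variations, carried out on
`sobolevPairs (interior D)`, the closure of the pairs `(φ, ∇φ)`, `φ ∈ C_c^∞(int D)`, in the Hilbert
space `L² × L²`. A weak gradient is characterized by orthogonality relations, so this closure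
consists of pairs `(u, ∇u)` and is `H¹₀(D)` (`mem_H10_iff`).

For zero charge the trivial state is a minimizer. For charge `C ≠ 0` the constraint gives
`ω = C / ‖u‖²`, so that on the constraint set the energy is
`ε²/2 ‖∇u‖² + ∫ W(u) + C² / (2 ‖u‖²)`. Since `W ≥ 0`, a minimizing sequence has bounded gradients
and `‖u_n‖` bounded away from `0`; by Poincaré's inequality it is bounded in `H¹`, hence converges
weakly along a subsequence (`exists_subseq_weak_tendsto`), strongly in `L²` by Rellich's theorem
(`tendsto_fst_of_weak`) and almost everywhere. The three terms of the energy are then handled by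
weak lower semicontinuity of the norm, by Fatou's lemma (`integral_comp_le_of_tendsto_ae`), and by
strong convergence. Since `W ≥ 0`, no compactness in `L^p` is needed: the growth of `N` enters only
through the integrability of `W(u)`, which follows from the Sobolev embedding (`memLp_fst`).

The Sobolev inequality for test functions (`exists_sobolev`) comes from the
Gagliardo–Nirenberg–Sobolev inequality, with Hölder's inequality on the bounded support when
`d = 2`, and from the fundamental theorem of calculus when `d = 1`; its case `q = 2` is Poincaré's
inequality. Rellich's theorem is proved by Fourier transform: frequencies `‖ξ‖ ≥ R` contribute at
most `(2πR)⁻² ‖∇φ‖²` to `‖φ‖²`, while weak convergence of functions supported in a fixed bounded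
set makes the Fourier transforms converge pointwise and boundedly, so that the low frequencies
converge by dominated convergence.
-/

namespace KleinGordon

open Filter Topology
open scoped ENNReal NNReal RealInnerProductSpace FourierTransform LineDeriv SchwartzMap

variable {d : ℕ} {U : Set (Space d)} {φ ψ : Space d → ℝ}

/-! ### Test functions and the Sobolev inequality -/

theorem gradient_apply (φ : Space d → ℝ) (x : Space d) (i : Fin d) :
    gradient φ x i = fderiv ℝ φ x (EuclideanSpace.single i 1) := by
  rw [← inner_gradient_left, EuclideanSpace.inner_single_right]
  simp

theorem norm_gradient (φ : Space d → ℝ) (x : Space d) : ‖gradient φ x‖ = ‖fderiv ℝ φ x‖ := by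
  rw [← toDual_gradient, LinearIsometryEquiv.norm_map]

theorem gradient_zero_fun (x : Space d) : gradient (0 : Space d → ℝ) x = 0 := by
  simp [gradient]

theorem tsupport_gradient_subset (φ : Space d → ℝ) : tsupport (gradient φ) ⊆ tsupport φ := by
  refine (closure_mono fun x hx => ?_).trans (tsupport_fderiv_subset ℝ)
  rw [Function.mem_support] at hx ⊢
  rwa [← norm_ne_zero_iff, ← norm_gradient, norm_ne_zero_iff]

namespace IsTestFunction

theorem zero : IsTestFunction U (0 : Space d → ℝ) where
  smooth := contDiff_const
  compactSupport := HasCompactSupport.zero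
  support_subset := by simp [tsupport]

theorem contDiff_one (h : IsTestFunction U φ) : ContDiff ℝ 1 φ := h.smooth.of_le (by simp)

theorem differentiable (h : IsTestFunction U φ) : Differentiable ℝ φ :=
  h.contDiff_one.differentiable one_ne_zero

theorem continuous (h : IsTestFunction U φ) : Continuous φ := h.smooth.continuous

theorem add (h : IsTestFunction U φ) (h' : IsTestFunction U ψ) : IsTestFunction U (φ + ψ) where
  smooth := h.smooth.add h'.smooth
  compactSupport := h.compactSupport.add h'.compactSupport
  support_subset := (tsupport_add φ ψ).trans (Set.union_subset h.support_subset h'.support_subset)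

theorem smul (c : ℝ) (h : IsTestFunction U φ) : IsTestFunction U (c • φ) where
  smooth := h.smooth.const_smul c
  compactSupport := h.compactSupport.smul_left (f := fun _ => c)
  support_subset := (tsupport_smul_subset_right (fun _ => c) φ).trans h.support_subset

theorem gradient_add (h : IsTestFunction U φ) (h' : IsTestFunction U ψ) :
    gradient (φ + ψ) = gradient φ + gradient ψ := by
  ext1 x
  simp [gradient, fderiv_add (h.differentiable x) (h'.differentiable x)]

theorem gradient_smul (c : ℝ) (h : IsTestFunction U φ) :
    gradient (c • φ) = c • gradient φ := by
  ext1 x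
  simp [gradient, fderiv_const_smul (h.differentiable x)]

theorem continuous_gradient (h : IsTestFunction U φ) : Continuous (gradient φ) :=
  (InnerProductSpace.toDual ℝ (Space d)).symm.continuous.comp
    (h.contDiff_one.continuous_fderiv one_ne_zero)

theorem hasCompactSupport_gradient (h : IsTestFunction U φ) : HasCompactSupport (gradient φ) :=
  h.compactSupport.mono' ((subset_tsupport _).trans (tsupport_gradient_subset φ))

theorem memLp (h : IsTestFunction U φ) (p : ℝ≥0∞) : MemLp φ p volume :=
  h.continuous.memLp_of_hasCompactSupport h.compactSupport

theorem memLp_gradient (h : IsTestFunction U φ) (p : ℝ≥0∞) : MemLp (gradient φ) p volume :=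
  h.continuous_gradient.memLp_of_hasCompactSupport h.hasCompactSupport_gradient

theorem isWeakGradient (h : IsTestFunction U φ) : IsWeakGradient φ (gradient φ) := by
  intro ψ hψ i
  have hcφ : Continuous fun x => fderiv ℝ φ x (EuclideanSpace.single i 1) :=
    (h.contDiff_one.continuous_fderiv one_ne_zero).clm_apply continuous_const
  have hcψ : Continuous fun x => fderiv ℝ ψ x (EuclideanSpace.single i 1) :=
    (hψ.contDiff_one.continuous_fderiv one_ne_zero).clm_apply continuous_const
  simp only [gradient_apply]
  refine integral_mul_fderiv_eq_neg_fderiv_mul_of_integrable ?_ ?_ ?_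
    (fun x _ => h.differentiable x) (fun x _ => hψ.differentiable x)
  · exact (hcφ.mul hψ.continuous).integrable_of_hasCompactSupport hψ.compactSupport.mul_left
  · exact (h.continuous.mul hcψ).integrable_of_hasCompactSupport h.compactSupport.mul_right
  · exact (h.continuous.mul hψ.continuous).integrable_of_hasCompactSupport
      h.compactSupport.mul_right

theorem eLpNorm_gradient (φ : Space d → ℝ) (p : ℝ≥0∞) :
    eLpNorm (gradient φ) p volume = eLpNorm (fderiv ℝ φ) p volume :=
  eLpNorm_congr_norm_ae (.of_forall (norm_gradient φ))

end IsTestFunction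

/-- Lower Lebesgue norms are controlled by higher ones, uniformly over functions supported in a
fixed bounded set, measurable or not. -/
theorem exists_eLpNorm_le_of_subset (hU : Bornology.IsBounded U) {E : Type*}
    [NormedAddCommGroup E] (p q : ℝ≥0∞) (hpq : p ≤ q) :
    ∃ C : ℝ≥0, ∀ f : Space d → E, AEStronglyMeasurable f volume → Function.support f ⊆ U →
      eLpNorm f p volume ≤ C * eLpNorm f q volume := by
  set V := closure U
  have hV : MeasurableSet V := isClosed_closure.measurableSet
  have hfin : volume V < ∞ := hU.closure.measure_lt_top
  by_cases hp : p = 0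
  · exact ⟨0, fun f _ _ => by simp [hp]⟩
  have hexp : 0 ≤ 1 / p.toReal - 1 / q.toReal := by
    rcases eq_or_ne q ∞ with rfl | hq
    · simp
    · have hp0 : 0 < p.toReal := ENNReal.toReal_pos hp (ne_top_of_le_ne_top hq hpq)
      exact sub_nonneg.2 (one_div_le_one_div_of_le hp0 (ENNReal.toReal_mono hq hpq))
  refine ⟨(volume V ^ (1 / p.toReal - 1 / q.toReal)).toNNReal, fun f hf hfU => ?_⟩
  have hr : ∀ r : ℝ≥0∞, eLpNorm f r (volume.restrict V) = eLpNorm f r volume := fun r =>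
    eLpNorm_restrict_eq_of_support_subset (hfU.trans subset_closure)
  rw [← hr p, ← hr q, ENNReal.coe_toNNReal (ENNReal.rpow_ne_top_of_nonneg hexp hfin.ne), mul_comm]
  simpa using eLpNorm_le_eLpNorm_mul_rpow_measure_univ (μ := volume.restrict V) hpq hf.restrict

/-- In dimension one a test function is bounded by the integral of its derivative. -/
theorem IsTestFunction.enorm_le_lintegral_gradient {U : Set (Space 1)} {φ : Space 1 → ℝ}
    (h : IsTestFunction U φ) (x : Space 1) : ‖φ x‖ₑ ≤ ∫⁻ y, ‖gradient φ y‖ₑ := by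
  let e : ℝ ≃ₗᵢ[ℝ] Space 1 := (OrthonormalBasis.singleton (Fin 1) ℝ).repr
  have hmp : MeasurePreserving e := e.measurePreserving
  have hcd : ContDiff ℝ 1 (φ ∘ e) := h.contDiff_one.comp e.contDiff
  have hcs : HasCompactSupport (φ ∘ e) := h.compactSupport.comp_homeomorph e.toHomeomorph
  have key := hcs.enorm_le_lintegral_Ici_deriv hcd (e.symm x)
  rw [Function.comp_apply, e.apply_symm_apply] at key
  refine key.trans ((setLIntegral_le_lintegral _ _).trans ?_)
  rw [← hmp.lintegral_comp h.continuous_gradient.enorm.measurable]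
  refine lintegral_mono fun t => ?_
  have hder : HasDerivAt (φ ∘ e) (fderiv ℝ φ (e t) (e 1)) t :=
    (h.differentiable (e t)).hasFDerivAt.comp_hasDerivAt t
      (e.toContinuousLinearEquiv.toContinuousLinearMap.hasDerivAt)
  rw [hder.deriv, enorm_le_iff_norm_le, norm_gradient]
  simpa using (fderiv ℝ φ (e t)).le_opNorm (e 1)

theorem exists_sobolev_dim_one {U : Set (Space 1)} (hU : Bornology.IsBounded U) (q : ℝ≥0) :
    ∃ C : ℝ≥0, ∀ φ : Space 1 → ℝ, IsTestFunction U φ →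
      eLpNorm φ q volume ≤ C * eLpNorm (gradient φ) 2 volume := by
  obtain ⟨C₁, hC₁⟩ := exists_eLpNorm_le_of_subset (E := ℝ) hU q ∞ le_top
  obtain ⟨C₂, hC₂⟩ := exists_eLpNorm_le_of_subset (E := Space 1) hU 1 2 one_le_two
  refine ⟨C₁ * C₂, fun φ hφ => ?_⟩
  have hsupp := (subset_tsupport φ).trans hφ.support_subset
  have hsupp' := (subset_tsupport _).trans ((tsupport_gradient_subset φ).trans hφ.support_subset)
  calc eLpNorm φ q volume
      ≤ C₁ * eLpNorm φ ∞ volume := hC₁ φ hφ.continuous.aestronglyMeasurable hsupp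
    _ ≤ C₁ * eLpNorm (gradient φ) 1 volume := by
      gcongr
      rw [eLpNorm_exponent_top, eLpNorm_one_eq_lintegral_enorm]
      exact essSup_le_of_ae_le _ (.of_forall hφ.enorm_le_lintegral_gradient)
    _ ≤ C₁ * (C₂ * eLpNorm (gradient φ) 2 volume) := by
      gcongr
      exact hC₂ _ hφ.continuous_gradient.aestronglyMeasurable hsupp'
    _ = _ := by push_cast; rw [mul_assoc]

/-- The Sobolev inequality on test functions supported in a bounded set, for `2 ≤ q < 2^*`. -/
theorem exists_sobolev (hd : 1 ≤ d) (hU : Bornology.IsBounded U) (q : ℝ≥0) (hq : 2 ≤ q)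
    (hq' : ((q : ℝ) : EReal) < criticalExponent d) :
    ∃ C : ℝ≥0, ∀ φ : Space d → ℝ, IsTestFunction U φ →
      eLpNorm φ q volume ≤ C * eLpNorm (gradient φ) 2 volume := by
  have hq0 : (0 : ℝ) < q := by exact_mod_cast (zero_lt_two.trans_le hq)
  rcases (show d = 1 ∨ d = 2 ∨ 3 ≤ d by omega) with rfl | rfl | hd3
  · exact exists_sobolev_dim_one hU q
  · -- `W^{1,p} ⊆ L^q` for the exponent `p < 2` with `1/p = 1/2 + 1/q`
    set p : ℝ≥0 := (1 / 2 + q⁻¹)⁻¹ with hp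
    have hqi : q⁻¹ ≤ 1 / 2 := by
      rw [one_div]; exact inv_anti₀ (by norm_num) hq
    have hqp : 0 < q⁻¹ := inv_pos.2 (by exact_mod_cast hq0)
    have hp1 : 1 ≤ p := by
      rw [hp]
      refine (one_le_inv₀ (by positivity)).2 ?_
      calc 1 / 2 + q⁻¹ ≤ 1 / 2 + 1 / 2 := by gcongr
        _ = 1 := by norm_num
    have hp2 : p < 2 := by
      rw [hp]
      refine inv_lt_of_inv_lt₀ (by norm_num) ?_
      rw [← one_div]
      exact lt_add_of_pos_right _ hqp
    obtain ⟨C, hC⟩ := exists_eLpNorm_le_of_subset (E := Space 2) hU (p : ℝ≥0∞) 2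
      (by exact_mod_cast hp2.le)
    refine ⟨eLpNormLESNormFDerivOfLeConst ℝ (volume : Measure (Space 2)) U p q * C,
      fun φ hφ => ?_⟩
    have := eLpNorm_le_eLpNorm_fderiv_of_le (volume : Measure (Space 2)) hφ.contDiff_one
      ((subset_tsupport φ).trans hφ.support_subset) hp1 (q := q) (by simpa using hp2)
      (by rw [hp]; push_cast; simp) hU
    rw [← IsTestFunction.eLpNorm_gradient] at this
    refine this.trans ?_
    push_cast
    rw [mul_assoc]
    gcongr
    exact hC _ hφ.continuous_gradient.aestronglyMeasurable
      ((subset_tsupport _).trans ((tsupport_gradient_subset φ).trans hφ.support_subset))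
  · refine ⟨eLpNormLESNormFDerivOfLeConst ℝ (volume : Measure (Space d)) U 2 q,
      fun φ hφ => ?_⟩
    rw [IsTestFunction.eLpNorm_gradient]
    have hd' : (2 : ℝ) < d := by exact_mod_cast hd3
    refine eLpNorm_le_eLpNorm_fderiv_of_le (volume : Measure (Space d)) hφ.contDiff_one
      ((subset_tsupport φ).trans hφ.support_subset) one_le_two (q := q)
      (by simp only [finrank_euclideanSpace, Fintype.card_fin]; exact_mod_cast hd') ?_ hU
    rw [criticalExponent, if_neg (by omega), EReal.coe_lt_coe_iff, lt_div_iff₀ (by linarith)] at hq'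
    rw [finrank_euclideanSpace, Fintype.card_fin, NNReal.coe_inv, NNReal.coe_ofNat, ← sub_nonneg]
    have : (q : ℝ)⁻¹ - ((2 : ℝ)⁻¹ - (d : ℝ)⁻¹) = (2 * d - q * (d - 2)) / (2 * q * d) := by
      have : (d : ℝ) ≠ 0 := by positivity
      field_simp
    rw [this]
    exact div_nonneg (by linarith) (by positivity)

/-! ### `H¹₀` as a closed subspace of a Hilbert space -/

/-- The Hilbert space `L²(ℝ^d) × L²(ℝ^d; ℝ^d)` in which `H¹(ℝ^d)` embeds by `u ↦ (u, ∇u)`; the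
norm it induces is the `H¹` norm. -/
abbrev L2Pair (d : ℕ) :=
  WithLp 2 (Lp ℝ 2 (volume : Measure (Space d)) × Lp (Space d) 2 (volume : Measure (Space d)))

/-- The pair `(φ, ∇φ)` attached to a test function. -/
noncomputable def IsTestFunction.toPair (h : IsTestFunction U φ) : L2Pair d :=
  WithLp.toLp 2 ((h.memLp 2).toLp φ, (h.memLp_gradient 2).toLp (gradient φ))

theorem IsTestFunction.coeFn_toPair_fst (h : IsTestFunction U φ) : h.toPair.fst =ᵐ[volume] φ :=
  (h.memLp 2).coeFn_toLp

theorem IsTestFunction.coeFn_toPair_snd (h : IsTestFunction U φ) :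
    h.toPair.snd =ᵐ[volume] gradient φ :=
  (h.memLp_gradient 2).coeFn_toLp

theorem IsTestFunction.norm_toPair_fst (h : IsTestFunction U φ) :
    ‖h.toPair.fst‖ = (eLpNorm φ 2 volume).toReal :=
  Lp.norm_toLp _ (h.memLp 2)

theorem IsTestFunction.norm_toPair_snd (h : IsTestFunction U φ) :
    ‖h.toPair.snd‖ = (eLpNorm (gradient φ) 2 volume).toReal :=
  Lp.norm_toLp _ (h.memLp_gradient 2)

/-- The subspace `{(φ, ∇φ) : φ ∈ C_c^∞(U)}`. -/
def testPairs (U : Set (Space d)) : Submodule ℝ (L2Pair d) where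
  carrier := {x | ∃ φ : Space d → ℝ, ∃ h : IsTestFunction U φ, h.toPair = x}
  zero_mem' := by
    refine ⟨0, IsTestFunction.zero, ?_⟩
    have : gradient (0 : Space d → ℝ) = 0 := funext gradient_zero_fun
    simp only [IsTestFunction.toPair, this]
    rfl
  add_mem' := by
    rintro _ _ ⟨φ, hφ, rfl⟩ ⟨ψ, hψ, rfl⟩
    refine ⟨φ + ψ, hφ.add hψ, ?_⟩
    simp only [IsTestFunction.toPair, hφ.gradient_add hψ]
    rfl
  smul_mem' := by
    rintro c _ ⟨φ, hφ, rfl⟩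
    refine ⟨c • φ, hφ.smul c, ?_⟩
    simp only [IsTestFunction.toPair, hφ.gradient_smul c]
    rfl

/-- `H¹₀(U)` as a closed subspace of the Hilbert space of pairs. -/
noncomputable def sobolevPairs (U : Set (Space d)) : Submodule ℝ (L2Pair d) :=
  (testPairs U).topologicalClosure

theorem IsTestFunction.toPair_mem (h : IsTestFunction U φ) : h.toPair ∈ sobolevPairs U :=
  (testPairs U).le_topologicalClosure ⟨φ, h, rfl⟩

/-- Being a weak gradient is a closed condition: for each test function it says that `(u, g)` is
orthogonal to a fixed vector. -/
theorem isWeakGradient_of_mem_sobolevPairs {x : L2Pair d} (hx : x ∈ sobolevPairs U) :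
    IsWeakGradient x.fst x.snd := by
  intro ψ hψ i
  have hm : MemLp (fun x => gradient ψ x i) 2 volume :=
    (hψ.memLp_gradient 2).eval_piLp i
  have hm' : MemLp (fun x => ψ x • EuclideanSpace.single i (1 : ℝ)) 2
      (volume : Measure (Space d)) :=
    (hψ.memLp 2).of_le
      ((Continuous.aestronglyMeasurable (by have := hψ.continuous; fun_prop)))
      (.of_forall fun x => by simp [norm_smul])
  let w : L2Pair d := WithLp.toLp 2 (hm.toLp _, hm'.toLp _)
  have hw : ∀ y : L2Pair d,
      ⟪w, y⟫ = (∫ x, y.fst x * gradient ψ x i) + ∫ x, y.snd x i * ψ x := by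
    intro y
    rw [WithLp.prod_inner_apply]
    congr 1
    · rw [L2.inner_def]
      refine integral_congr_ae ?_
      filter_upwards [hm.coeFn_toLp] with x hx
      simp [w, hx]
    · rw [L2.inner_def]
      refine integral_congr_ae ?_
      filter_upwards [hm'.coeFn_toLp] with x hx
      simp [w, hx, inner_smul_left, EuclideanSpace.inner_single_left, mul_comm]
  have hle : sobolevPairs U ≤ LinearMap.ker (innerSL ℝ w).toLinearMap := by
    refine Submodule.topologicalClosure_minimal _ ?_ (innerSL ℝ w).isClosed_ker
    rintro _ ⟨φ, hφ, rfl⟩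
    change ⟪w, _⟫ = 0
    rw [hw]
    have h1 : ∫ x, hφ.toPair.fst x * gradient ψ x i = ∫ x, φ x * gradient ψ x i := by
      refine integral_congr_ae ?_
      filter_upwards [hφ.coeFn_toPair_fst] with x hx
      rw [hx]
    have h2 : ∫ x, hφ.toPair.snd x i * ψ x = ∫ x, gradient φ x i * ψ x := by
      refine integral_congr_ae ?_
      filter_upwards [hφ.coeFn_toPair_snd] with x hx
      rw [hx]
    rw [h1, h2, hφ.isWeakGradient ψ hψ i]
    ring
  have : ⟪w, x⟫ = 0 := hle hx
  rw [hw] at this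
  linarith

/-- The embedding `u ↦ (u, ∇u)`. -/
noncomputable def H1.toPair (u : H1 d) : L2Pair d := WithLp.toLp 2 (u.fn, u.grad)

theorem edist_le_add_of_prod (x y : L2Pair d) :
    edist x y ≤ edist x.fst y.fst + edist x.snd y.snd := by
  simp only [edist_eq_enorm_sub, enorm, ← ENNReal.coe_add, ENNReal.coe_le_coe]
  rw [← NNReal.coe_le_coe]
  push_cast
  rw [WithLp.prod_norm_eq_of_L2]
  refine Real.sqrt_le_iff.2 ⟨by positivity, ?_⟩
  simp only [WithLp.sub_fst, WithLp.sub_snd]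
  nlinarith [norm_nonneg (x.fst - y.fst), norm_nonneg (x.snd - y.snd)]

theorem norm_fst_le (x : L2Pair d) : ‖x.fst‖ ≤ ‖x‖ := by
  rw [WithLp.prod_norm_eq_of_L2]
  exact Real.le_sqrt_of_sq_le (by nlinarith [sq_nonneg ‖x.snd‖])

theorem norm_snd_le (x : L2Pair d) : ‖x.snd‖ ≤ ‖x‖ := by
  rw [WithLp.prod_norm_eq_of_L2]
  exact Real.le_sqrt_of_sq_le (by nlinarith [sq_nonneg ‖x.fst‖])

theorem eLpNorm_sub_eq_edist {E : Type*} [NormedAddCommGroup E]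
    (f : Lp E 2 (volume : Measure (Space d))) {g : Space d → E} (hg : MemLp g 2 volume) :
    eLpNorm (fun x => f x - g x) 2 volume = edist f (hg.toLp g) := by
  rw [Lp.edist_def]
  refine eLpNorm_congr_ae ?_
  filter_upwards [hg.coeFn_toLp] with x hx
  simp [hx]

theorem mem_H10_iff {D : Set (Space d)} {u : H1 d} :
    u ∈ H10 D ↔ u.toPair ∈ sobolevPairs (interior D) := by
  change _ ↔ u.toPair ∈ closure (testPairs (interior D) : Set (L2Pair d))
  rw [EMetric.mem_closure_iff]
  constructor
  · intro hu δ hδ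
    obtain ⟨φ, hφ, h1, h2⟩ := hu (δ / 2) (ENNReal.half_pos hδ.ne')
    refine ⟨hφ.toPair, ⟨φ, hφ, rfl⟩, ?_⟩
    rw [eLpNorm_sub_eq_edist _ (hφ.memLp 2)] at h1
    rw [eLpNorm_sub_eq_edist _ (hφ.memLp_gradient 2)] at h2
    refine (edist_le_add_of_prod u.toPair hφ.toPair).trans_lt ?_
    rw [← ENNReal.add_halves δ]
    exact ENNReal.add_lt_add h1 h2
  · intro hu δ hδ
    obtain ⟨_, ⟨φ, hφ, rfl⟩, h⟩ := hu δ hδ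
    refine ⟨φ, hφ, ?_, ?_⟩
    · rw [eLpNorm_sub_eq_edist _ (hφ.memLp 2)]
      refine lt_of_le_of_lt ?_ h
      simp only [edist_eq_enorm_sub, enorm_le_iff_norm_le]
      exact norm_fst_le (u.toPair - hφ.toPair)
    · rw [eLpNorm_sub_eq_edist _ (hφ.memLp_gradient 2)]
      refine lt_of_le_of_lt ?_ h
      simp only [edist_eq_enorm_sub, enorm_le_iff_norm_le]
      exact norm_snd_le (u.toPair - hφ.toPair)

theorem exists_H10_of_mem_sobolevPairs {D : Set (Space d)} {x : L2Pair d}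
    (hx : x ∈ sobolevPairs (interior D)) : ∃ u ∈ H10 D, u.toPair = x :=
  ⟨⟨x.fst, x.snd, isWeakGradient_of_mem_sobolevPairs hx⟩, mem_H10_iff.2 hx, rfl⟩

/-- Elements of `H¹₀(U)` are limits of test functions. -/
theorem exists_seq_testFunction {x : L2Pair d} (hx : x ∈ sobolevPairs U) :
    ∃ φ : ℕ → Space d → ℝ, ∃ h : ∀ n, IsTestFunction U (φ n),
      Tendsto (fun n => (h n).toPair) atTop (𝓝 x) := by
  obtain ⟨y, hy, hlim⟩ := mem_closure_iff_seq_limit.1 hx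
  choose φ h hφ using hy
  exact ⟨φ, h, by simpa only [hφ] using hlim⟩

/-! ### Rellich's theorem for test functions -/

namespace IsTestFunction

/-- A test function, complexified, as a Schwartz function. -/
noncomputable def toSchwartz (h : IsTestFunction U φ) : 𝓢(Space d, ℂ) :=
  (h.compactSupport.comp_left (g := ((↑) : ℝ → ℂ)) Complex.ofReal_zero).toSchwartzMap
    (Complex.ofRealCLM.contDiff.comp h.smooth)

theorem toSchwartz_apply (h : IsTestFunction U φ) (x : Space d) : h.toSchwartz x = (φ x : ℂ) := rfl

theorem integrable_sq (h : IsTestFunction U φ) : Integrable (fun x => φ x ^ 2) volume :=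
  (h.memLp 2).integrable_sq

/-- Plancherel's theorem for a test function. -/
theorem integral_norm_sq_fourier (h : IsTestFunction U φ) :
    ∫ ξ, ‖𝓕 h.toSchwartz ξ‖ ^ 2 = ∫ x, φ x ^ 2 := by
  rw [SchwartzMap.integral_norm_sq_fourier]
  simp [toSchwartz_apply]

theorem integrable_norm_sq_schwartz (f : 𝓢(Space d, ℂ)) :
    Integrable (fun x => ‖f x‖ ^ 2) volume := (f.memLp 2).integrable_norm_pow two_ne_zero

theorem norm_sq_fourier_lineDeriv (h : IsTestFunction U φ) (i : Fin d) (ξ : Space d) :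
    ‖𝓕 (∂_{EuclideanSpace.single i (1 : ℝ)} h.toSchwartz) ξ‖ ^ 2 =
      (2 * Real.pi) ^ 2 * (ξ i ^ 2 * ‖𝓕 h.toSchwartz ξ‖ ^ 2) := by
  have ht : (inner ℝ · (EuclideanSpace.single i (1 : ℝ)) : Space d → ℝ).HasTemperateGrowth :=
    ((innerSL ℝ).flip _).hasTemperateGrowth
  rw [SchwartzMap.fourier_lineDerivOp_eq, _root_.smul_apply,
    SchwartzMap.smulLeftCLM_apply_apply ht]
  simp [EuclideanSpace.inner_single_right, mul_pow, abs_of_pos Real.pi_pos]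

theorem lineDeriv_toSchwartz (h : IsTestFunction U φ) (i : Fin d) (x : Space d) :
    ∂_{EuclideanSpace.single i (1 : ℝ)} h.toSchwartz x = (gradient φ x i : ℂ) := by
  rw [SchwartzMap.lineDerivOp_apply_eq_fderiv, gradient_apply]
  have : HasFDerivAt h.toSchwartz (Complex.ofRealCLM.comp (fderiv ℝ φ x)) x :=
    Complex.ofRealCLM.hasFDerivAt.comp x (h.differentiable x).hasFDerivAt
  rw [this.fderiv]
  rfl

/-- Plancherel's theorem for the gradient of a test function. -/
theorem integral_norm_sq_gradient (h : IsTestFunction U φ) :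
    Integrable (fun ξ => ‖ξ‖ ^ 2 * ‖𝓕 h.toSchwartz ξ‖ ^ 2) volume ∧
    ∫ x, ‖gradient φ x‖ ^ 2 = (2 * Real.pi) ^ 2 * ∫ ξ, ‖ξ‖ ^ 2 * ‖𝓕 h.toSchwartz ξ‖ ^ 2 := by
  have hpi : (2 * Real.pi) ^ 2 ≠ 0 := by positivity
  have hint : ∀ i, Integrable (fun ξ : Space d => ξ i ^ 2 * ‖𝓕 h.toSchwartz ξ‖ ^ 2) volume := by
    intro i
    have := integrable_norm_sq_schwartz (𝓕 (∂_{EuclideanSpace.single i (1 : ℝ)} h.toSchwartz))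
    simp only [norm_sq_fourier_lineDeriv] at this
    exact (integrable_const_mul_iff (IsUnit.mk0 _ hpi) _).1 this
  have hint' : ∀ i, Integrable (fun x => gradient φ x i ^ 2) volume := fun i =>
    ((h.memLp_gradient 2).eval_piLp i).integrable_sq
  have hξ : ∀ ξ : Space d, ‖ξ‖ ^ 2 * ‖𝓕 h.toSchwartz ξ‖ ^ 2
      = ∑ i, ξ i ^ 2 * ‖𝓕 h.toSchwartz ξ‖ ^ 2 := fun ξ => by
    rw [EuclideanSpace.norm_sq_eq, Finset.sum_mul]
    simp
  simp only [hξ]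
  refine ⟨integrable_finsetSum _ fun i _ => hint i, ?_⟩
  rw [integral_finsetSum _ fun i _ => hint i, Finset.mul_sum]
  simp only [EuclideanSpace.norm_sq_eq, Real.norm_eq_abs, sq_abs]
  rw [integral_finsetSum _ fun i _ => hint' i]
  refine Finset.sum_congr rfl fun i _ => ?_
  rw [← integral_const_mul]
  simp only [← norm_sq_fourier_lineDeriv]
  rw [SchwartzMap.integral_norm_sq_fourier]
  simp [lineDeriv_toSchwartz]

/-- Frequency splitting: up to an error controlled by the gradient, the `L²` norm of a test
function lives on low frequencies. -/
theorem integral_sq_le_lowFrequency (h : IsTestFunction U φ) {R : ℝ} (hR : 0 < R) :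
    ∫ x, φ x ^ 2 ≤ (∫ ξ in Metric.ball 0 R, ‖𝓕 h.toSchwartz ξ‖ ^ 2)
      + ((2 * Real.pi * R) ^ 2)⁻¹ * ∫ x, ‖gradient φ x‖ ^ 2 := by
  obtain ⟨hint, heq⟩ := h.integral_norm_sq_gradient
  have hF := integrable_norm_sq_schwartz (𝓕 h.toSchwartz)
  rw [← h.integral_norm_sq_fourier, heq,
    ← integral_add_compl (measurableSet_ball (x := (0 : Space d)) (ε := R)) hF]
  gcongr
  calc ∫ ξ in (Metric.ball 0 R)ᶜ, ‖𝓕 h.toSchwartz ξ‖ ^ 2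
      ≤ ∫ ξ in (Metric.ball 0 R)ᶜ, (R ^ 2)⁻¹ * (‖ξ‖ ^ 2 * ‖𝓕 h.toSchwartz ξ‖ ^ 2) := by
        refine setIntegral_mono_on hF.integrableOn (hint.const_mul _).integrableOn
          measurableSet_ball.compl fun ξ hξ => ?_
        have hξ' : R ≤ ‖ξ‖ := by simpa using hξ
        rw [← mul_assoc]
        refine le_mul_of_one_le_left (by positivity) ?_
        rw [inv_mul_eq_div, one_le_div (by positivity)]
        gcongr
    _ ≤ ∫ ξ, (R ^ 2)⁻¹ * (‖ξ‖ ^ 2 * ‖𝓕 h.toSchwartz ξ‖ ^ 2) :=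
        setIntegral_le_integral (hint.const_mul _) (.of_forall fun ξ => by positivity)
    _ = _ := by
        rw [integral_const_mul]
        field_simp

theorem norm_fourier_le (h : IsTestFunction U φ) (ξ : Space d) :
    ‖𝓕 h.toSchwartz ξ‖ ≤ ∫ x, |φ x| := by
  rw [SchwartzMap.fourier_coe, Real.fourier_eq]
  refine (norm_integral_le_integral_norm _).trans_eq ?_
  simp [toSchwartz_apply]

/-- The Fourier transform of a test function at a fixed frequency is computed by two real
`L²(U)` pairings. -/
theorem fourier_eq_pairing (h : IsTestFunction U φ) (ξ : Space d) :
    𝓕 h.toSchwartz ξ =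
      ((∫ x, U.indicator (fun x => Real.cos (2 * Real.pi * ⟪x, ξ⟫)) x * φ x : ℝ) : ℂ) +
      ((∫ x, U.indicator (fun x => -Real.sin (2 * Real.pi * ⟪x, ξ⟫)) x * φ x : ℝ) : ℂ)
        * Complex.I := by
  have hφ : Integrable φ volume := memLp_one_iff_integrable.1 (h.memLp 1)
  have hz : ∀ x ∉ U, φ x = 0 := fun x hx => by
    by_contra hne
    exact hx (h.support_subset (subset_tsupport φ hne))
  have hcut : ∀ g : Space d → ℝ, (fun x => U.indicator g x * φ x) = fun x => g x * φ x := by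
    intro g
    ext x
    by_cases hx : x ∈ U
    · simp [hx]
    · simp [hz x hx]
  have hmeas : AEStronglyMeasurable (fun x : Space d => Real.cos (2 * Real.pi * ⟪x, ξ⟫)) volume :=
    Continuous.aestronglyMeasurable (by fun_prop)
  have hmeas' : AEStronglyMeasurable (fun x : Space d => -Real.sin (2 * Real.pi * ⟪x, ξ⟫))
    volume := Continuous.aestronglyMeasurable (by fun_prop)
  have h1 : Integrable (fun x => Real.cos (2 * Real.pi * ⟪x, ξ⟫) * φ x) volume :=
    hφ.bdd_mul hmeas (.of_forall fun x => Real.abs_cos_le_one _)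
  have h2 : Integrable (fun x => -Real.sin (2 * Real.pi * ⟪x, ξ⟫) * φ x) volume :=
    hφ.bdd_mul hmeas' (.of_forall fun x => by
      rw [norm_neg]; exact Real.abs_sin_le_one _)
  rw [hcut, hcut, SchwartzMap.fourier_coe, Real.fourier_eq', ← integral_complex_ofReal,
    ← integral_complex_ofReal, ← integral_mul_const, ← integral_add h1.ofReal
    (h2.ofReal.mul_const _)]
  congr 1
  ext x
  rw [toSchwartz_apply, smul_eq_mul, Complex.exp_mul_I]
  push_cast
  rw [show (-2 * Real.pi * (⟪x, ξ⟫ : ℝ) : ℂ) = -(2 * Real.pi * (⟪x, ξ⟫ : ℝ)) by ring,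
    Complex.cos_neg, Complex.sin_neg]
  ring

end IsTestFunction

/-- **Rellich's theorem** along a filter: test functions supported in a fixed bounded set, bounded
in `H¹` and weakly convergent to `0` in `L²`, converge to `0` in `L²`. -/
theorem tendsto_integral_sq_of_weak (hU : Bornology.IsBounded U) (hUm : MeasurableSet U)
    {ι : Type*} {l : Filter ι} [l.IsCountablyGenerated] {w : ι → Space d → ℝ}
    (hw : ∀ i, IsTestFunction U (w i)) {M : ℝ} (hM : ∀ i, ∫ x, w i x ^ 2 ≤ M)
    (hM' : ∀ i, ∫ x, ‖gradient (w i) x‖ ^ 2 ≤ M)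
    (hweak : ∀ g : Space d → ℝ, MemLp g 2 volume →
      Tendsto (fun i => ∫ x, g x * w i x) l (𝓝 0)) :
    Tendsto (fun i => ∫ x, w i x ^ 2) l (𝓝 0) := by
  have hfin : volume U < ∞ := hU.measure_lt_top
  -- pointwise convergence of the Fourier transforms
  have hpt : ∀ ξ, Tendsto (fun i => 𝓕 (hw i).toSchwartz ξ) l (𝓝 0) := by
    intro ξ
    have hg : ∀ g : Space d → ℝ, Continuous g → (∀ x, |g x| ≤ 1) →
        MemLp (U.indicator g) 2 volume := fun g hgc hg1 => by
      rw [memLp_indicator_iff_restrict hUm]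
      have : IsFiniteMeasure (volume.restrict U) := ⟨by simpa using hfin⟩
      exact MemLp.of_bound hgc.aestronglyMeasurable 1 (.of_forall hg1)
    have h1 := hweak _ (hg (fun x => Real.cos (2 * Real.pi * ⟪x, ξ⟫)) (by fun_prop)
      fun x => Real.abs_cos_le_one _)
    have h2 := hweak _ (hg (fun x => -Real.sin (2 * Real.pi * ⟪x, ξ⟫)) (by fun_prop)
      fun x => by rw [abs_neg]; exact Real.abs_sin_le_one _)
    simp only [IsTestFunction.fourier_eq_pairing]
    simpa using ((Complex.continuous_ofReal.tendsto 0).comp h1).add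
      (((Complex.continuous_ofReal.tendsto 0).comp h2).mul_const Complex.I)
  -- the uniform bound `‖w‖_1 ≤ |U| + ‖w‖_2²`, from `|t| ≤ 1 + t²` on `U`
  have hbd : ∀ i ξ, ‖𝓕 (hw i).toSchwartz ξ‖ ≤ volume.real U + M := by
    intro i ξ
    refine ((hw i).norm_fourier_le ξ).trans ?_
    have hi : Integrable (U.indicator (fun _ => (1 : ℝ))) (volume : Measure (Space d)) :=
      (integrable_indicator_iff hUm).2 (integrableOn_const hfin.ne)
    calc ∫ x, |w i x| ≤ ∫ x, (U.indicator (fun _ => (1 : ℝ)) x + w i x ^ 2) := by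
          refine integral_mono (memLp_one_iff_integrable.1 ((hw i).memLp 1)).abs
            (hi.add (hw i).integrable_sq) fun x => ?_
          by_cases hx : x ∈ U
          · simp only [hx, Set.indicator_of_mem]
            nlinarith [sq_abs (w i x), sq_nonneg (|w i x| - 1), abs_nonneg (w i x)]
          · have : w i x = 0 := by
              by_contra hne
              exact hx ((hw i).support_subset (subset_tsupport _ hne))
            simp [this, hx]
      _ = volume.real U + ∫ x, w i x ^ 2 := by
          rw [integral_add hi (hw i).integrable_sq, integral_indicator_const _ hUm]
          simp
      _ ≤ _ := by gcongr; exact hM i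
  -- low frequencies converge by dominated convergence
  have hlow : ∀ R : ℝ, Tendsto
      (fun i => ∫ ξ in Metric.ball 0 R, ‖𝓕 (hw i).toSchwartz ξ‖ ^ 2) l (𝓝 0) := by
    intro R
    have : IsFiniteMeasure ((volume : Measure (Space d)).restrict (Metric.ball 0 R)) :=
      ⟨by simpa using measure_ball_lt_top⟩
    have := tendsto_integral_filter_of_dominated_convergence
      (μ := (volume : Measure (Space d)).restrict (Metric.ball 0 R)) (l := l)
      (F := fun i ξ => ‖𝓕 (hw i).toSchwartz ξ‖ ^ 2) (f := fun _ => 0)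
      (fun _ => (volume.real U + M) ^ 2)
      (.of_forall fun i => ((𝓕 (hw i).toSchwartz).continuous.norm.pow 2).aestronglyMeasurable)
      (.of_forall fun i => .of_forall fun ξ => by
        rw [Real.norm_of_nonneg (by positivity)]
        exact pow_le_pow_left₀ (norm_nonneg _) (hbd i ξ) 2)
      (integrable_const _)
      (.of_forall fun ξ => by simpa using ((hpt ξ).norm.pow 2))
    simpa using this
  rcases l.eq_or_neBot with rfl | hl
  · exact tendsto_bot
  have hM0 : 0 ≤ M := by
    obtain ⟨i⟩ : Nonempty ι := l.nonempty_of_neBot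
    exact (integral_nonneg fun x => sq_nonneg _).trans (hM i)
  rw [Metric.tendsto_nhds]
  intro δ hδ
  have htail : Tendsto (fun R : ℝ => ((2 * Real.pi * R) ^ 2)⁻¹ * M) atTop (𝓝 0) := by
    have h1 : Tendsto (fun R : ℝ => (2 * Real.pi * R) ^ 2) atTop atTop :=
      (tendsto_pow_atTop two_ne_zero).comp
        (tendsto_id.const_mul_atTop (by positivity : 0 < 2 * Real.pi))
    simpa using (tendsto_inv_atTop_zero.comp h1).mul_const M
  obtain ⟨R, hRδ, hR⟩ := ((htail.eventually_lt_const (half_pos hδ)).and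
    (eventually_gt_atTop 0)).exists
  filter_upwards [(hlow R).eventually_lt_const (half_pos hδ)] with i hi
  rw [Real.dist_0_eq_abs, abs_of_nonneg (integral_nonneg fun x => sq_nonneg _)]
  calc _ ≤ _ := (hw i).integral_sq_le_lowFrequency hR
    _ ≤ (∫ ξ in Metric.ball 0 R, ‖𝓕 (hw i).toSchwartz ξ‖ ^ 2) + ((2 * Real.pi * R) ^ 2)⁻¹ * M := by
      gcongr; exact hM' i
    _ < δ / 2 + δ / 2 := add_lt_add hi hRδ
    _ = δ := add_halves δ

/-! ### Compactness and embeddings of `H¹₀` -/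

/-- Bounded sequences in a separable Hilbert space have weakly convergent subsequences: sequential
Banach–Alaoglu, transported by the Riesz isomorphism. -/
theorem exists_subseq_weak_tendsto {H : Type*} [NormedAddCommGroup H] [InnerProductSpace ℝ H]
    [CompleteSpace H] [TopologicalSpace.SeparableSpace H] {x : ℕ → H} {M : ℝ}
    (hx : ∀ n, ‖x n‖ ≤ M) :
    ∃ a : H, ∃ k : ℕ → ℕ, StrictMono k ∧ ∀ y, Tendsto (fun n => ⟪y, x (k n)⟫) atTop (𝓝 ⟪y, a⟫) := by
  obtain ⟨f, -, k, hk, hlim⟩ := WeakDual.isSeqCompact_closedBall ℝ H 0 M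
    (x := fun n => StrongDual.toWeakDual (InnerProductSpace.toDual ℝ H (x n)))
    (fun n => by simpa using hx n)
  refine ⟨(InnerProductSpace.toDual ℝ H).symm (WeakDual.toStrongDual f), k, hk, fun y => ?_⟩
  have h := ((WeakDual.eval_continuous y).tendsto f).comp hlim
  have h1 : ⟪y, (InnerProductSpace.toDual ℝ H).symm (WeakDual.toStrongDual f)⟫ = f y := by
    rw [real_inner_comm, InnerProductSpace.toDual_symm_apply]; rfl
  rw [h1]
  refine h.congr fun n => ?_
  rw [real_inner_comm]
  rfl

/-- Closed subspaces are weakly sequentially closed. -/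
theorem mem_of_weak_tendsto {H : Type*} [NormedAddCommGroup H] [InnerProductSpace ℝ H]
    [CompleteSpace H] {K : Submodule ℝ H} (hK : IsClosed (K : Set H)) {x : ℕ → H} {a : H}
    (hx : ∀ n, x n ∈ K) (h : ∀ y, Tendsto (fun n => ⟪y, x n⟫) atTop (𝓝 ⟪y, a⟫)) : a ∈ K := by
  have : K.HasOrthogonalProjection :=
    have : CompleteSpace K := hK.completeSpace_coe
    inferInstance
  rw [← K.orthogonal_orthogonal, Submodule.mem_orthogonal]
  intro y hy
  refine tendsto_nhds_unique (h y) ?_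
  simp only [fun n => (K.mem_orthogonal' y).1 hy _ (hx n)]
  exact tendsto_const_nhds

theorem norm_sq_eq_integral {E : Type*} [NormedAddCommGroup E] [InnerProductSpace ℝ E]
    (f : Lp E 2 (volume : Measure (Space d))) : ‖f‖ ^ 2 = ∫ x, ‖f x‖ ^ 2 := by
  rw [← real_inner_self_eq_norm_sq, L2.inner_def]
  simp

theorem IsTestFunction.integral_sq (h : IsTestFunction U φ) :
    ∫ x, φ x ^ 2 = ‖h.toPair.fst‖ ^ 2 := by
  rw [norm_sq_eq_integral]
  refine integral_congr_ae ?_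
  filter_upwards [h.coeFn_toPair_fst] with x hx
  rw [hx, Real.norm_eq_abs, sq_abs]

theorem IsTestFunction.integral_gradient_sq (h : IsTestFunction U φ) :
    ∫ x, ‖gradient φ x‖ ^ 2 = ‖h.toPair.snd‖ ^ 2 := by
  rw [norm_sq_eq_integral]
  refine integral_congr_ae ?_
  filter_upwards [h.coeFn_toPair_snd] with x hx
  rw [hx]

/-- **Rellich's theorem**: on `H¹₀(U)`, `U` bounded, weak `H¹` convergence implies strong `L²`
convergence. -/
theorem tendsto_fst_of_weak (hU : Bornology.IsBounded U) (hUm : MeasurableSet U)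
    {x : ℕ → L2Pair d} {a : L2Pair d} (hx : ∀ n, x n ∈ sobolevPairs U) (ha : a ∈ sobolevPairs U)
    {M : ℝ} (hM : ∀ n, ‖x n‖ ≤ M)
    (h : ∀ y, Tendsto (fun n => ⟪y, x n⟫) atTop (𝓝 ⟪y, a⟫)) :
    Tendsto (fun n => (x n).fst) atTop (𝓝 a.fst) := by
  -- replace `x n - a` by nearby test functions, which converge weakly to `0` as well
  have happrox : ∀ n : ℕ, ∃ φ : Space d → ℝ, ∃ h : IsTestFunction U φ,
      ‖x n - a - h.toPair‖ < 1 / ((n : ℝ) + 1) := by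
    intro n
    have hmem : x n - a ∈ closure (testPairs U : Set (L2Pair d)) :=
      (sobolevPairs U).sub_mem (hx n) ha
    obtain ⟨_, ⟨φ, hφ, rfl⟩, hd⟩ :=
      Metric.mem_closure_iff.1 hmem _ (Nat.one_div_pos_of_nat (n := n))
    exact ⟨φ, hφ, by rwa [← dist_eq_norm]⟩
  choose w hw hwx using happrox
  have herr : Tendsto (fun n => x n - a - (hw n).toPair) atTop (𝓝 0) :=
    squeeze_zero_norm (fun n => (hwx n).le) tendsto_one_div_add_atTop_nhds_zero_nat
  have hwM : ∀ n, ‖(hw n).toPair‖ ≤ M + ‖a‖ + 1 := by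
    intro n
    have h1 : (hw n).toPair = x n - a - (x n - a - (hw n).toPair) := by abel
    have h2 : 1 / ((n : ℝ) + 1) ≤ 1 := by
      rw [div_le_one (by positivity)]; simp
    rw [h1]
    refine (norm_sub_le _ _).trans ?_
    have := norm_sub_le (x n) a
    linarith [hM n, hwx n]
  have hweak : ∀ y, Tendsto (fun n => ⟪y, (hw n).toPair⟫) atTop (𝓝 0) := by
    intro y
    have h1 : Tendsto (fun n => ⟪y, x n⟫ - ⟪y, a⟫ - ⟪y, x n - a - (hw n).toPair⟫) atTop
        (𝓝 (⟪y, a⟫ - ⟪y, a⟫ - ⟪y, (0 : L2Pair d)⟫)) :=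
      ((h y).sub_const _).sub ((continuous_const.inner continuous_id).tendsto 0 |>.comp herr)
    rw [sub_self, inner_zero_right, sub_zero] at h1
    refine h1.congr fun n => ?_
    simp only [inner_sub_right]
    ring
  have hstrong : Tendsto (fun n => ∫ x, w n x ^ 2) atTop (𝓝 0) := by
    refine tendsto_integral_sq_of_weak hU hUm hw (M := (M + ‖a‖ + 1) ^ 2) (fun n => ?_)
      (fun n => ?_) fun g hg => ?_
    · rw [(hw n).integral_sq]
      exact pow_le_pow_left₀ (norm_nonneg _) ((norm_fst_le _).trans (hwM n)) 2
    · rw [(hw n).integral_gradient_sq]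
      exact pow_le_pow_left₀ (norm_nonneg _) ((norm_snd_le _).trans (hwM n)) 2
    · refine (hweak (WithLp.toLp 2 (hg.toLp g, 0))).congr fun n => ?_
      rw [WithLp.prod_inner_apply, L2.inner_def]
      simp only [inner_zero_left, add_zero]
      refine integral_congr_ae ?_
      filter_upwards [hg.coeFn_toLp, (hw n).coeFn_toPair_fst] with x hx hx'
      rw [hx]
      change ⟪g x, (hw n).toPair.fst x⟫ = _
      rw [hx']
      simp [mul_comm]
  have hw0 : Tendsto (fun n => (hw n).toPair.fst) atTop (𝓝 0) := by
    rw [tendsto_zero_iff_norm_tendsto_zero]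
    have := hstrong.sqrt
    simp only [fun n => (hw n).integral_sq, Real.sqrt_sq (norm_nonneg _), Real.sqrt_zero] at this
    exact this
  have herr1 : Tendsto (fun n => (x n - a - (hw n).toPair).fst) atTop (𝓝 0) :=
    squeeze_zero_norm (fun n => (norm_fst_le _).trans (hwx n).le)
      tendsto_one_div_add_atTop_nhds_zero_nat
  have := (herr1.add hw0).add_const a.fst
  rw [add_zero, zero_add] at this
  refine this.congr fun n => ?_
  simp

/-- **Poincaré's inequality** on `H¹₀(U)`. -/
theorem exists_poincare (hd : 1 ≤ d) (hU : Bornology.IsBounded U) :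
    ∃ C : ℝ, ∀ x ∈ sobolevPairs U, ‖x.fst‖ ≤ C * ‖x.snd‖ := by
  have h2 : (((2 : ℝ≥0) : ℝ) : EReal) < criticalExponent d := by
    rw [criticalExponent]
    split_ifs with h
    · exact EReal.coe_lt_top _
    · have : (2 : ℝ) < d := by exact_mod_cast not_le.1 h
      rw [EReal.coe_lt_coe_iff, lt_div_iff₀ (by linarith), NNReal.coe_ofNat]
      linarith
  obtain ⟨C, hC⟩ := exists_sobolev hd hU 2 le_rfl h2
  refine ⟨C, fun x hx => ?_⟩
  obtain ⟨φ, hφ, hlim⟩ := exists_seq_testFunction hx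
  have hf : Continuous fun y : L2Pair d => ‖y.fst‖ :=
    (WithLp.prod_continuous_ofLp 2 _ _).fst.norm
  have hs : Continuous fun y : L2Pair d => C * ‖y.snd‖ :=
    (WithLp.prod_continuous_ofLp 2 _ _).snd.norm.const_mul _
  refine le_of_tendsto_of_tendsto' ((hf.tendsto x).comp hlim) ((hs.tendsto x).comp hlim)
    fun n => ?_
  have h := hC _ (hφ n)
  rw [Function.comp_apply, Function.comp_apply, (hφ n).norm_toPair_fst, (hφ n).norm_toPair_snd,
    ← ENNReal.coe_toReal, ← ENNReal.toReal_mul]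
  exact ENNReal.toReal_mono
    (ENNReal.mul_ne_top ENNReal.coe_ne_top ((hφ n).memLp_gradient 2).eLpNorm_ne_top) h

/-- Along a subsequence, `L²` convergence is convergence almost everywhere. -/
theorem exists_subseq_ae {E : Type*} [NormedAddCommGroup E]
    {f : ℕ → Lp E 2 (volume : Measure (Space d))} {g : Lp E 2 (volume : Measure (Space d))}
    (h : Tendsto f atTop (𝓝 g)) : ∃ k : ℕ → ℕ, StrictMono k ∧
      ∀ᵐ x, Tendsto (fun n => f (k n) x) atTop (𝓝 (g x)) :=
  (tendstoInMeasure_of_tendsto_Lp h).exists_seq_tendsto_ae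

/-- **Sobolev embedding** `H¹₀(U) ⊆ L^q`, `2 ≤ q < 2^*`. -/
theorem memLp_fst (hd : 1 ≤ d) (hU : Bornology.IsBounded U) (q : ℝ≥0) (hq : 2 ≤ q)
    (hq' : ((q : ℝ) : EReal) < criticalExponent d) {x : L2Pair d} (hx : x ∈ sobolevPairs U) :
    MemLp x.fst q volume := by
  -- the Sobolev bound passes to the limit of approximating test functions by Fatou's lemma
  obtain ⟨C, hC⟩ := exists_sobolev hd hU q hq hq'
  obtain ⟨φ, hφ, hlim⟩ := exists_seq_testFunction hx
  have hf : Tendsto (fun n => (hφ n).toPair.fst) atTop (𝓝 x.fst) :=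
    ((WithLp.prod_continuous_ofLp 2 _ _).fst.tendsto x).comp hlim
  obtain ⟨k, -, hk⟩ := exists_subseq_ae hf
  obtain ⟨M, hM⟩ : ∃ M : ℝ, ∀ n, ‖(hφ n).toPair‖ ≤ M := by
    obtain ⟨M, hM⟩ := hlim.norm.bddAbove_range
    exact ⟨M, fun n => hM ⟨n, rfl⟩⟩
  refine ⟨Lp.aestronglyMeasurable _, ?_⟩
  refine (Lp.eLpNorm_lim_le_liminf_eLpNorm (fun n => Lp.aestronglyMeasurable _) _ hk).trans_lt ?_
  refine lt_of_le_of_lt (b := C * ENNReal.ofReal M) ?_ (by finiteness)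
  refine (liminf_le_liminf (v := fun _ => C * ENNReal.ofReal M) (.of_forall fun n => ?_)).trans
    (by simp)
  calc eLpNorm (hφ (k n)).toPair.fst q volume
      = eLpNorm (φ (k n)) q volume := eLpNorm_congr_ae (hφ (k n)).coeFn_toPair_fst
    _ ≤ C * eLpNorm (gradient (φ (k n))) 2 volume := hC _ (hφ (k n))
    _ ≤ _ := by
      gcongr
      refine ENNReal.le_ofReal_iff_toReal_le ((hφ (k n)).memLp_gradient 2).eLpNorm_ne_top
        ((norm_nonneg _).trans (hM 0)) |>.2 ?_
      rw [← (hφ (k n)).norm_toPair_snd]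
      exact (norm_snd_le _).trans (hM _)

/-- An `L²` limit of functions supported in `U` vanishes almost everywhere off `U`. -/
theorem ae_eq_zero_of_approx {E : Type*} [NormedAddCommGroup E]
    {f : Space d → E} (hf : AEStronglyMeasurable f volume) (hU : MeasurableSet U)
    (h : ∀ δ : ℝ≥0∞, 0 < δ → ∃ g : Space d → E, Function.support g ⊆ U ∧
      eLpNorm (fun x => f x - g x) 2 volume < δ) :
    ∀ᵐ x, x ∉ U → f x = 0 := by
  have h0 : eLpNorm f 2 (volume.restrict Uᶜ) = 0 := by
    by_contra hne
    obtain ⟨g, hg, hlt⟩ := h _ (pos_iff_ne_zero.2 hne)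
    refine hlt.not_ge ?_
    refine le_trans (eLpNorm_congr_ae ?_).le
      (eLpNorm_mono_measure _ (Measure.restrict_le_self (s := Uᶜ)))
    filter_upwards [ae_restrict_mem hU.compl] with x hx
    have : g x = 0 := by
      by_contra hgx
      exact hx (hg hgx)
    simp [this]
  rw [eLpNorm_eq_zero_iff hf.restrict two_ne_zero] at h0
  exact (ae_restrict_iff' hU.compl).1 h0

theorem ae_eq_zero_of_mem_H10 {D : Set (Space d)} {u : H1 d} (hu : u ∈ H10 D) :
    ∀ᵐ x, x ∉ D → u.fn x = 0 ∧ u.grad x = 0 := by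
  have h1 : ∀ᵐ x, x ∉ interior D → u.fn x = 0 :=
    ae_eq_zero_of_approx (Lp.aestronglyMeasurable _) isOpen_interior.measurableSet fun δ hδ => by
      obtain ⟨φ, hφ, h, -⟩ := hu δ hδ
      exact ⟨φ, (subset_tsupport φ).trans hφ.support_subset, h⟩
  have h2 : ∀ᵐ x, x ∉ interior D → u.grad x = 0 :=
    ae_eq_zero_of_approx (Lp.aestronglyMeasurable _) isOpen_interior.measurableSet fun δ hδ => by
      obtain ⟨φ, hφ, -, h⟩ := hu δ hδ
      exact ⟨gradient φ, (subset_tsupport _).trans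
        ((tsupport_gradient_subset φ).trans hφ.support_subset), h⟩
  filter_upwards [h1, h2] with x hx hx' hxD
  exact ⟨hx fun h => hxD (interior_subset h), hx' fun h => hxD (interior_subset h)⟩

/-! ### The energy and its minimizers -/

instance secondCountableTopology_L2Pair : SecondCountableTopology (L2Pair d) := by
  have : Fact ((2 : ℝ≥0∞) ≠ ∞) := ⟨by simp⟩
  have h₁ : SecondCountableTopology (Lp ℝ 2 (volume : Measure (Space d))) := inferInstance
  have h₂ : SecondCountableTopology (Lp (Space d) 2 (volume : Measure (Space d))) := inferInstance
  exact WithLp.secondCountableTopology 2 _ _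

theorem norm_toPair_sq (u : H1 d) : ‖u.toPair‖ ^ 2 = ‖u.fn‖ ^ 2 + ‖u.grad‖ ^ 2 :=
  WithLp.prod_norm_sq_eq_of_L2 _

theorem continuous_potential {Ω : ℝ} {N : ℝ → ℝ} (hN : IsAdmissible d N) :
    Continuous (potential Ω N) := by
  have := hN.differentiable.continuous
  unfold potential
  fun_prop

/-- The growth condition on `N'` integrates to subcritical growth of the potential. -/
theorem exists_potential_le {Ω : ℝ} {N : ℝ → ℝ} (hN : IsAdmissible d N) :
    ∃ A : ℝ, ∃ p : ℝ≥0, 2 ≤ p ∧ ((p : ℝ) : EReal) < criticalExponent d ∧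
      ∀ s, |potential Ω N s| ≤ A * (|s| ^ 2 + |s| ^ (p : ℝ)) := by
  obtain ⟨c₁, c₂, q, p, hc₁, hc₂, hq, hqp, hp, hgrow⟩ := hN.growth
  have hp0 : 0 ≤ p := by linarith
  refine ⟨Ω ^ 2 / 2 + (c₁ + c₂), p.toNNReal, ?_, ?_, fun s => ?_⟩
  · rw [← NNReal.coe_le_coe, Real.coe_toNNReal p hp0, NNReal.coe_ofNat]
    linarith
  · rwa [Real.coe_toNNReal p hp0]
  rw [Real.coe_toNNReal p hp0]
  have hmv : |N s| ≤ (c₁ * |s| ^ (q - 1) + c₂ * |s| ^ (p - 1)) * |s| := by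
    have := (convex_closedBall (0 : ℝ) |s|).norm_image_sub_le_of_norm_deriv_le
      (f := N) (C := c₁ * |s| ^ (q - 1) + c₂ * |s| ^ (p - 1)) (x := 0) (y := s)
      (fun x _ => hN.differentiable x) (fun x hx => ?_) (by simp) (by simp)
    · simpa [hN.zero] using this
    · have hx' : |x| ≤ |s| := by simpa using hx
      refine (hgrow x).trans ?_
      gcongr <;> linarith
  have hs0 := abs_nonneg s
  have hpow : ∀ r : ℝ, 2 < r → |s| ^ (r - 1) * |s| = |s| ^ r := fun r hr => by
    rw [← Real.rpow_add_one' hs0 (by linarith), sub_add_cancel]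
  have hinterp : |s| ^ q ≤ |s| ^ 2 + |s| ^ p := by
    have h2 := pow_nonneg hs0 2
    have h3 := Real.rpow_nonneg hs0 p
    rcases le_total |s| 1 with h | h
    · have : |s| ^ q ≤ |s| ^ (2 : ℝ) :=
        Real.rpow_le_rpow_of_exponent_ge' hs0 h (by norm_num) hq.le
      rw [Real.rpow_two] at this
      linarith
    · linarith [Real.rpow_le_rpow_of_exponent_le h hqp]
  have hp2 : |s| ^ p ≤ |s| ^ 2 + |s| ^ p := by linarith [pow_nonneg hs0 2]
  have hs2 : |s| ^ 2 ≤ |s| ^ 2 + |s| ^ p := by linarith [Real.rpow_nonneg hs0 p]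
  calc |potential Ω N s| ≤ Ω ^ 2 / 2 * |s| ^ 2 + |N s| := by
        refine (abs_add_le _ _).trans_eq ?_
        rw [abs_of_nonneg (by positivity)]
    _ ≤ Ω ^ 2 / 2 * |s| ^ 2 + (c₁ * |s| ^ q + c₂ * |s| ^ p) := by
        rw [← hpow q hq, ← hpow p (by linarith)]
        linarith
    _ ≤ Ω ^ 2 / 2 * (|s| ^ 2 + |s| ^ p)
        + (c₁ * (|s| ^ 2 + |s| ^ p) + c₂ * (|s| ^ 2 + |s| ^ p)) := by gcongr
    _ = _ := by ring

theorem integrable_potential (hd : 1 ≤ d) {Ω : ℝ} {N : ℝ → ℝ} (hN : IsAdmissible d N)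
    {D : Set (Space d)} (hD : Bornology.IsBounded D) {u : H1 d} (hu : u ∈ H10 D) :
    Integrable (fun x => potential Ω N (u.fn x)) volume := by
  obtain ⟨A, p, hp, hp', hA⟩ := exists_potential_le (Ω := Ω) hN
  have hLp : MemLp u.fn p volume :=
    memLp_fst hd (hD.subset interior_subset) p hp hp' (mem_H10_iff.1 hu)
  have h2 : Integrable (fun x => |u.fn x| ^ 2) volume :=
    (Lp.memLp u.fn).integrable_norm_pow two_ne_zero
  have hp0 : p ≠ 0 := (zero_lt_two.trans_le hp).ne'
  have h3 : Integrable (fun x => |u.fn x| ^ (p : ℝ)) volume := by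
    simpa using hLp.integrable_norm_rpow (by simpa using hp0) ENNReal.coe_ne_top
  refine ((h2.add h3).const_mul A).mono' ?_ (.of_forall fun x => hA _)
  exact (continuous_potential hN).comp_aestronglyMeasurable (Lp.aestronglyMeasurable _)

theorem integrable_grad_sq (u : H1 d) : Integrable (fun x => ‖u.grad x‖ ^ 2) volume :=
  (Lp.memLp u.grad).integrable_norm_pow two_ne_zero

theorem integrable_fn_sq (u : H1 d) : Integrable (fun x => u.fn x ^ 2) volume :=
  (Lp.memLp u.fn).integrable_sq

theorem integrable_energyDensity (hd : 1 ≤ d) {Ω : ℝ} {N : ℝ → ℝ} (hN : IsAdmissible d N)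
    {D : Set (Space d)} (hD : Bornology.IsBounded D) (ε : ℝ) {u : H1 d} (hu : u ∈ H10 D) (ω : ℝ) :
    Integrable (energyDensity (potential Ω N) ε u ω) volume :=
  ((((integrable_grad_sq u).div_const 2).const_mul _).add (integrable_potential hd hN hD hu)).add
    (((integrable_fn_sq u).const_mul _).div_const 2)

theorem setIntegral_fn_sq {D : Set (Space d)} {u : H1 d} (hu : u ∈ H10 D) :
    ∫ x in D, u.fn x ^ 2 = ‖u.fn‖ ^ 2 := by
  rw [setIntegral_eq_integral_of_ae_compl_eq_zero, norm_sq_eq_integral]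
  · simp
  · filter_upwards [ae_eq_zero_of_mem_H10 hu] with x hx hxD
    simp [(hx hxD).1]

/-- The energy in terms of integrals over the whole space. Since `u` and `∇u` vanish almost
everywhere off `D`, this needs no measurability of `D`. -/
theorem energy_eq (hd : 1 ≤ d) {Ω : ℝ} {N : ℝ → ℝ} (hN : IsAdmissible d N)
    {D : Set (Space d)} (hD : Bornology.IsBounded D) (ε : ℝ) {u : H1 d} (hu : u ∈ H10 D) (ω : ℝ) :
    energy (potential Ω N) ε D (u, ω) =
      ε ^ 2 / 2 * ‖u.grad‖ ^ 2 + (∫ x, potential Ω N (u.fn x)) + ω ^ 2 / 2 * ‖u.fn‖ ^ 2 := by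
  have hglob : energy (potential Ω N) ε D (u, ω) =
      ∫ x, energyDensity (potential Ω N) ε u ω x := by
    refine setIntegral_eq_integral_of_ae_compl_eq_zero ?_
    filter_upwards [ae_eq_zero_of_mem_H10 hu] with x hx hxD
    simp [energyDensity, potential, (hx hxD).1, (hx hxD).2, hN.zero]
  rw [hglob, norm_sq_eq_integral, norm_sq_eq_integral]
  have h1 := ((integrable_grad_sq u).div_const 2).const_mul (ε ^ 2)
  have h2 := integrable_potential (Ω := Ω) hd hN hD hu
  have h3 := ((integrable_fn_sq u).const_mul (ω ^ 2)).div_const 2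
  have h12 : Integrable (fun x => ε ^ 2 * (‖u.grad x‖ ^ 2 / 2) + potential Ω N (u.fn x)) volume :=
    h1.add h2
  simp only [energyDensity]
  rw [integral_add h12 h3, integral_add h1 h2]
  simp only [integral_const_mul, integral_div, Real.norm_eq_abs, sq_abs]
  ring

/-- On the constraint with charge `C ≠ 0` the frequency can be eliminated from the energy. -/
theorem frequency_term_eq {C ω n : ℝ} (hn : n ≠ 0) (h : ω * n = C) :
    ω ^ 2 / 2 * n = C ^ 2 / (2 * n) := by
  subst h
  field_simp

/-- Fatou's lemma for Bochner integrals of nonnegative continuous functions along an a.e.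
convergent sequence. -/
theorem integral_comp_le_of_tendsto_ae {W : ℝ → ℝ} (hW : Continuous W) (hW0 : ∀ s, 0 ≤ W s)
    {f : ℕ → Space d → ℝ} {g : Space d → ℝ} (hf : ∀ n, Integrable (fun x => W (f n x)) volume)
    (hfm : ∀ n, AEStronglyMeasurable (f n) volume)
    (hlim : ∀ᵐ x, Tendsto (fun n => f n x) atTop (𝓝 (g x)))
    {b : ℕ → ℝ} {b₀ : ℝ} (hb : ∀ n, ∫ x, W (f n x) ≤ b n) (hb₀ : Tendsto b atTop (𝓝 b₀)) :
    ∫ x, W (g x) ≤ b₀ := by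
  have hb0 : 0 ≤ b₀ := ge_of_tendsto' hb₀ fun n => (integral_nonneg fun x => hW0 _).trans (hb n)
  have hgm : AEStronglyMeasurable g volume := aestronglyMeasurable_of_tendsto_ae atTop hfm hlim
  rw [integral_eq_lintegral_of_nonneg_ae (.of_forall fun x => hW0 _)
    (hW.comp_aestronglyMeasurable hgm)]
  refine ENNReal.toReal_le_of_le_ofReal hb0 ?_
  calc ∫⁻ x, ENNReal.ofReal (W (g x))
      = ∫⁻ x, liminf (fun n => ENNReal.ofReal (W (f n x))) atTop := by
        refine lintegral_congr_ae ?_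
        filter_upwards [hlim] with x hx
        exact (((ENNReal.continuous_ofReal.comp hW).tendsto (g x)).comp hx).liminf_eq.symm
    _ ≤ liminf (fun n => ∫⁻ x, ENNReal.ofReal (W (f n x))) atTop :=
        lintegral_liminf_le' fun n =>
          (hW.comp_aestronglyMeasurable (hfm n)).aemeasurable.ennreal_ofReal
    _ ≤ liminf (fun n => ENNReal.ofReal (b n)) atTop := by
        refine liminf_le_liminf (.of_forall fun n => ?_)
        rw [← ofReal_integral_eq_lintegral_ofReal (hf n) (.of_forall fun x => hW0 _)]
        exact ENNReal.ofReal_le_ofReal (hb n)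
    _ = ENNReal.ofReal b₀ := ((ENNReal.continuous_ofReal.tendsto b₀).comp hb₀).liminf_eq

/-- A set with non-empty interior carries a nonzero element of `H¹₀`. -/
theorem exists_H10_fn_ne_zero {D : Set (Space d)} (hD : (interior D).Nonempty) :
    ∃ u ∈ H10 D, u.fn ≠ 0 := by
  obtain ⟨x₀, hx₀⟩ := hD
  obtain ⟨r, hr, hball⟩ := Metric.nhds_basis_closedBall.mem_iff.1
    (isOpen_interior.mem_nhds hx₀)
  let f : ContDiffBump x₀ := ⟨r / 2, r, half_pos hr, half_lt_self hr⟩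
  have hf : IsTestFunction (interior D) f :=
    ⟨f.contDiff, f.hasCompactSupport, by rw [f.tsupport_eq]; exact hball⟩
  obtain ⟨u, hu, hux⟩ := exists_H10_of_mem_sobolevPairs hf.toPair_mem
  refine ⟨u, hu, fun h0 => ?_⟩
  have h1 : u.fn = hf.toPair.fst := congrArg WithLp.fst hux
  have h2 : (f : Space d → ℝ) =ᵐ[volume] 0 := by
    filter_upwards [hf.coeFn_toPair_fst, Lp.coeFn_zero ℝ 2 (volume : Measure (Space d))]
      with x hx hx'
    rw [← hx, ← h1, h0, hx']
  have h3 := (Continuous.ae_eq_iff_eq volume f.continuous continuous_const).1 h2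
  have h4 : f x₀ = 0 := congrFun h3 x₀
  rw [f.one_of_mem_closedBall (by simp [f.rIn_pos.le])] at h4
  exact one_ne_zero h4

theorem constraint_nonempty {D : Set (Space d)} (hD : (interior D).Nonempty) (C : ℝ) :
    (constraint C D).Nonempty := by
  obtain ⟨u, hu, hne⟩ := exists_H10_fn_ne_zero hD
  refine ⟨(u, C / ‖u.fn‖ ^ 2), hu, ?_⟩
  rw [setIntegral_fn_sq hu]
  exact div_mul_cancel₀ _ (pow_ne_zero 2 (norm_ne_zero_iff.2 hne))

theorem energy_nonneg {W : ℝ → ℝ} (hW : ∀ s, 0 ≤ W s) (ε : ℝ) (D : Set (Space d))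
    (z : H1 d × ℝ) : 0 ≤ energy W ε D z :=
  integral_nonneg fun x => by
    have := hW (z.1.fn x)
    simp only [energyDensity, Pi.zero_apply]
    positivity

/-- For charge zero the trivial state is a minimizer. -/
theorem exists_minimizer_zero (hd : 1 ≤ d) {Ω : ℝ} {N : ℝ → ℝ} (hN : IsAdmissible d N)
    (hW : ∀ s, 0 ≤ potential Ω N s) {D : Set (Space d)} (hD : Bornology.IsBounded D) (ε : ℝ) :
    ∃ z ∈ constraint 0 D, ∀ z' ∈ constraint 0 D,
      energy (potential Ω N) ε D z ≤ energy (potential Ω N) ε D z' := by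
  obtain ⟨u, hu, hu0⟩ := exists_H10_of_mem_sobolevPairs (sobolevPairs (interior D)).zero_mem
  have hfn : u.fn = 0 := congrArg WithLp.fst hu0
  have hgrad : u.grad = 0 := congrArg WithLp.snd hu0
  refine ⟨(u, 0), ⟨hu, zero_mul _⟩, fun z' _ => ?_⟩
  refine le_trans (le_of_eq ?_) (energy_nonneg hW ε D z')
  have hpot : ∫ x, potential Ω N (u.fn x) = 0 := by
    refine integral_eq_zero_of_ae ?_
    rw [hfn]
    filter_upwards [Lp.coeFn_zero ℝ 2 (volume : Measure (Space d))] with x hx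
    rw [hx]
    simp [potential, hN.zero]
  rw [energy_eq hd hN hD ε hu, hpot, hfn, hgrad]
  simp

/-- The direct method for nonzero charge. Along a minimizing sequence the constraint keeps
`‖u‖_{L²}` away from `0`, since the frequency term equals `C² / (2 ‖u‖²)`. -/
theorem exists_minimizer_of_ne_zero (hd : 1 ≤ d) {Ω : ℝ} {N : ℝ → ℝ} (hN : IsAdmissible d N)
    (hW : ∀ s, 0 ≤ potential Ω N s) {D : Set (Space d)} (hD : Bornology.IsBounded D)
    (hD' : (interior D).Nonempty) {ε : ℝ} (hε : 0 < ε) {C : ℝ} (hC : C ≠ 0) :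
    ∃ z ∈ constraint C D, ∀ z' ∈ constraint C D,
      energy (potential Ω N) ε D z ≤ energy (potential Ω N) ε D z' := by
  set E := energy (potential Ω N) ε D
  have hU : Bornology.IsBounded (interior D) := hD.subset interior_subset
  have hbdd : BddBelow (E '' constraint C D) :=
    ⟨0, by rintro _ ⟨z, -, rfl⟩; exact energy_nonneg hW ε D z⟩
  obtain ⟨e, hanti, hlim, hmem⟩ :=
    exists_seq_tendsto_sInf ((constraint_nonempty hD' C).image E) hbdd
  choose z hz hze using hmem
  set m := sInf (E '' constraint C D)
  -- the energy of an admissible pair with the frequency eliminated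
  have hne : ∀ n, ‖(z n).1.fn‖ ^ 2 ≠ 0 := fun n h0 => hC <| by
    rw [← (hz n).2, setIntegral_fn_sq (hz n).1, h0, mul_zero]
  have hI0 : ∀ n, 0 ≤ ∫ x, potential Ω N ((z n).1.fn x) := fun n => integral_nonneg fun x => hW _
  have hen : ∀ n, e n = ε ^ 2 / 2 * ‖(z n).1.grad‖ ^ 2
      + (∫ x, potential Ω N ((z n).1.fn x)) + C ^ 2 / (2 * ‖(z n).1.fn‖ ^ 2) := fun n => by
    have h := (hz n).2
    rw [setIntegral_fn_sq (hz n).1] at h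
    rw [← hze n, ← frequency_term_eq (hne n) h]
    exact energy_eq hd hN hD ε (hz n).1 _
  have hpos : ∀ n, 0 < ‖(z n).1.fn‖ ^ 2 := fun n => (sq_nonneg _).lt_of_ne' (hne n)
  have hB : ∀ n, e n ≤ e 0 := fun n => hanti (Nat.zero_le n)
  have hfreq : ∀ n, 0 < C ^ 2 / (2 * ‖(z n).1.fn‖ ^ 2) := fun n => by
    have := hpos n
    positivity
  have he0 : 0 < e 0 := by
    rw [hen 0]
    have := hI0 0
    have := hfreq 0
    positivity
  have hlower : ∀ n, C ^ 2 / (2 * e 0) ≤ ‖(z n).1.fn‖ ^ 2 := fun n => by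
    have h1 : C ^ 2 / (2 * ‖(z n).1.fn‖ ^ 2) ≤ e 0 := by
      refine le_trans ?_ (hB n)
      rw [hen n]
      have := hI0 n
      have : 0 ≤ ε ^ 2 / 2 * ‖(z n).1.grad‖ ^ 2 := by positivity
      linarith
    rw [div_le_iff₀ (by have := hpos n; positivity)] at h1
    rw [div_le_iff₀ (by positivity)]
    linarith
  -- the sequence is bounded in `H¹`
  obtain ⟨P, hP⟩ := exists_poincare hd hU
  set G := Real.sqrt (2 * e 0 / ε ^ 2) with hG
  have hgrad : ∀ n, ‖(z n).1.grad‖ ≤ G := fun n => by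
    refine Real.le_sqrt_of_sq_le ?_
    rw [le_div_iff₀ (by positivity)]
    have h1 := hB n
    rw [hen n] at h1
    linarith [hI0 n, hfreq n]
  have hx : ∀ n, (z n).1.toPair ∈ sobolevPairs (interior D) := fun n => mem_H10_iff.1 (hz n).1
  have hfn : ∀ n, ‖(z n).1.fn‖ ≤ |P| * G := fun n =>
    (hP _ (hx n)).trans <| (mul_le_mul_of_nonneg_right (le_abs_self P) (norm_nonneg _)).trans <|
      mul_le_mul_of_nonneg_left (hgrad n) (abs_nonneg P)
  have hbound : ∀ n, ‖(z n).1.toPair‖ ≤ Real.sqrt ((|P| * G) ^ 2 + G ^ 2) := fun n => by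
    refine Real.le_sqrt_of_sq_le ?_
    rw [norm_toPair_sq]
    gcongr
    · exact hfn n
    · exact hgrad n
  -- weak limit in `H¹₀`, strong limit in `L²`, limit almost everywhere
  obtain ⟨a, k, hk, hweak⟩ := exists_subseq_weak_tendsto hbound
  have ha : a ∈ sobolevPairs (interior D) :=
    mem_of_weak_tendsto (Submodule.isClosed_topologicalClosure _) (fun n => hx (k n)) hweak
  have hstrong := tendsto_fst_of_weak hU isOpen_interior.measurableSet (fun n => hx (k n)) ha
    (fun n => hbound (k n)) hweak
  obtain ⟨j, hj, hae⟩ := exists_subseq_ae hstrong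
  obtain ⟨u, hu, rfl⟩ := exists_H10_of_mem_sobolevPairs ha
  have hkj : Tendsto (fun n => k (j n)) atTop atTop := hk.tendsto_atTop.comp hj.tendsto_atTop
  have hnorm : Tendsto (fun n => ‖(z (k (j n))).1.fn‖ ^ 2) atTop (𝓝 (‖u.fn‖ ^ 2)) :=
    ((hstrong.comp hj.tendsto_atTop).norm).pow 2
  have hupos : 0 < ‖u.fn‖ ^ 2 :=
    lt_of_lt_of_le (by positivity) (ge_of_tendsto' hnorm fun n => hlower _)
  have hweakgrad : Tendsto (fun n => ⟪u.grad, (z (k (j n))).1.grad⟫) atTop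
      (𝓝 (‖u.grad‖ ^ 2)) := by
    have h := (hweak (WithLp.toLp 2 (0, u.grad))).comp hj.tendsto_atTop
    simp only [WithLp.prod_inner_apply, inner_zero_left, zero_add] at h
    rw [← real_inner_self_eq_norm_sq]
    exact h
  have hcon : (u, C / ‖u.fn‖ ^ 2) ∈ constraint C D := by
    refine ⟨hu, ?_⟩
    rw [setIntegral_fn_sq hu]
    exact div_mul_cancel₀ _ hupos.ne'
  refine ⟨(u, C / ‖u.fn‖ ^ 2), hcon, fun z' hz' => ?_⟩
  refine le_trans ?_ (csInf_le hbdd ⟨z', hz', rfl⟩)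
  change E _ ≤ m
  have hEu : E (u, C / ‖u.fn‖ ^ 2) = ε ^ 2 / 2 * ‖u.grad‖ ^ 2
      + (∫ x, potential Ω N (u.fn x)) + C ^ 2 / (2 * ‖u.fn‖ ^ 2) := by
    rw [← frequency_term_eq hupos.ne' (div_mul_cancel₀ C hupos.ne')]
    exact energy_eq hd hN hD ε hu _
  -- `‖∇u_n‖² ≥ 2⟪∇u, ∇u_n⟫ - ‖∇u‖²` turns the weak convergence of the gradients into an upper
  -- bound with a limit for the potential energies, to which Fatou's lemma applies
  have hpot : ∫ x, potential Ω N (u.fn x) ≤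
      m - ε ^ 2 / 2 * (2 * ‖u.grad‖ ^ 2 - ‖u.grad‖ ^ 2) - C ^ 2 / (2 * ‖u.fn‖ ^ 2) := by
    refine integral_comp_le_of_tendsto_ae (continuous_potential hN) hW
      (f := fun n => (z (k (j n))).1.fn)
      (b := fun n => e (k (j n))
        - ε ^ 2 / 2 * (2 * ⟪u.grad, (z (k (j n))).1.grad⟫ - ‖u.grad‖ ^ 2)
        - C ^ 2 / (2 * ‖(z (k (j n))).1.fn‖ ^ 2))
      (fun n => integrable_potential hd hN hD (hz _).1) (fun n => Lp.aestronglyMeasurable _)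
      hae (fun n => ?_) ?_
    · have h1 : 2 * ⟪u.grad, (z (k (j n))).1.grad⟫ - ‖u.grad‖ ^ 2
          ≤ ‖(z (k (j n))).1.grad‖ ^ 2 := by
        have := norm_sub_sq_real u.grad (z (k (j n))).1.grad
        nlinarith [sq_nonneg ‖u.grad - (z (k (j n))).1.grad‖]
      have h2 := mul_le_mul_of_nonneg_left h1 (by positivity : 0 ≤ ε ^ 2 / 2)
      have h3 := hen (k (j n))
      linarith
    · exact ((hlim.comp hkj).sub (((hweakgrad.const_mul 2).sub_const _).const_mul _)).sub
        (tendsto_const_nhds.div (hnorm.const_mul 2) (by positivity))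
  rw [hEu]
  linarith

end KleinGordon

theorem mainTheorem2 (d : ℕ) (hd : 1 ≤ d) (Ω : ℝ) (N : ℝ → ℝ)
    (hN : KleinGordon.IsAdmissible d N)
    (hW : ∀ s : ℝ, 0 ≤ KleinGordon.potential Ω N s)
    (D : Set (KleinGordon.Space d)) (hD : Bornology.IsBounded D) (hD' : (interior D).Nonempty)
    (ε : ℝ) (hε : 0 < ε) (σ : ℝ) :
    (∀ u ∈ KleinGordon.H10 D, ∀ ω : ℝ,
      MeasureTheory.IntegrableOn
        (KleinGordon.energyDensity (KleinGordon.potential Ω N) ε u ω) D) ∧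
    ∃ z ∈ KleinGordon.constraint (σ * ε ^ d) D,
      KleinGordon.energy (KleinGordon.potential Ω N) ε D z =
        KleinGordon.minEnergy (KleinGordon.potential Ω N) σ ε D ∧
      ∀ z' ∈ KleinGordon.constraint (σ * ε ^ d) D,
        KleinGordon.energy (KleinGordon.potential Ω N) ε D z ≤
          KleinGordon.energy (KleinGordon.potential Ω N) ε D z' := by
  refine ⟨fun u hu ω =>
    (KleinGordon.integrable_energyDensity hd hN hD ε hu ω).integrableOn, ?_⟩
  obtain ⟨z, hz, hmin⟩ : ∃ z ∈ KleinGordon.constraint (σ * ε ^ d) D,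
      ∀ z' ∈ KleinGordon.constraint (σ * ε ^ d) D,
        KleinGordon.energy (KleinGordon.potential Ω N) ε D z ≤
          KleinGordon.energy (KleinGordon.potential Ω N) ε D z' := by
    rcases eq_or_ne (σ * ε ^ d) 0 with h0 | hne
    · rw [h0]
      exact KleinGordon.exists_minimizer_zero hd hN hW hD ε
    · exact KleinGordon.exists_minimizer_of_ne_zero hd hN hW hD hD' hε hne
  have hleast : IsLeast (KleinGordon.energy (KleinGordon.potential Ω N) ε D ''
      KleinGordon.constraint (σ * ε ^ d) D)
      (KleinGordon.energy (KleinGordon.potential Ω N) ε D z) :=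
    ⟨⟨z, hz, rfl⟩, by rintro _ ⟨z', hz', rfl⟩; exact hmin z' hz'⟩
  exact ⟨z, hz, hleast.csInf_eq.symm, hmin⟩
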